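/- Let $X$ be a non-zero separable real Banach space. Write $B_Y$ and $S_Y$ for the closed unit ball and the unit sphere of a Banach space $Y$, and regard $X$ as a subspace of its bidual $X^{**}$ through the canonical embedding. Recall that $X$ has the Daugavet property if every bounded linear operator $T:X\to X$ of rank one satisfies $\|T+I\|=1+\|T\|$. The following assertions are equivalent: (1) $X$ has the Daugavet property. (2) For every $x\in S_X$, every non-empty relatively weakly open subset $W$ of $B_X$ and every $\varepsilon>0$ there exists $y\in W$ such that $\|x+y\|>2-\varepsilon$. (3) For every non-empty relatively weak-star open subset $W$ of $B_{X^{**}}$ there exists $u\in S_{X^{**}}\cap W$ such that $\|x+u\|=1+\|x\|$ holds for every $x\in X$. (4) The set of all $u\in S_{X^{**}}$ such that $\|x+u\|=1+\|x\|$ holds for every $x\in X$ is weak-star dense in $S_{X^{**}}$. -/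

import Mathlib

set_option maxSynthPendingDepth 3

/-- A real Banach space `X` has the *Daugavet property* if every bounded linear operator
`T : X → X` of rank one satisfies the Daugavet equation `‖T + I‖ = 1 + ‖T‖`. -/
def HasDaugavetProperty (X : Type*) [NormedAddCommGroup X] [NormedSpace ℝ X] : Prop :=
  ∀ T : X →L[ℝ] X, Module.finrank ℝ (LinearMap.range (T : X →ₗ[ℝ] X)) = 1 →
    ‖T + ContinuousLinearMap.id ℝ X‖ = 1 + ‖T‖

/-- The (topological) bidual `X**`, with its operator norm. -/
abbrev Bidual (X : Type*) [NormedAddCommGroup X] [NormedSpace ℝ X] : Type _ :=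
  StrongDual ℝ (StrongDual ℝ X)

/-- `W` is a relatively weakly open subset of the closed unit ball `B_X`. -/
def IsRelWeaklyOpenInBall {X : Type*} [NormedAddCommGroup X] [NormedSpace ℝ X]
    (W : Set X) : Prop :=
  ∃ V : Set (WeakSpace ℝ X), IsOpen V ∧
    W = Metric.closedBall (0 : X) 1 ∩ (toWeakSpace ℝ X) ⁻¹' V

/-- `W` is a relatively weak-star open subset of the closed unit ball `B_{X**}`, where the
weak-star topology of `X**` is the one induced by its predual `X*`. -/
def IsRelWeakStarOpenInBidualBall {X : Type*} [NormedAddCommGroup X] [NormedSpace ℝ X]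
    (W : Set (Bidual X)) : Prop :=
  ∃ V : Set (WeakDual ℝ (StrongDual ℝ X)), IsOpen V ∧
    W = Metric.closedBall (0 : Bidual X) 1 ∩ StrongDual.toWeakDual ⁻¹' V

/-- The set of the norm-one elements `u` of `X**` with `‖x + u‖ = 1 + ‖x‖` for all `x ∈ X`, where
`X` is regarded as a subspace of `X**` through the canonical embedding. -/
def octahedralElements (X : Type*) [NormedAddCommGroup X] [NormedSpace ℝ X] :
    Set (Bidual X) :=
  {u | u ∈ Metric.sphere (0 : Bidual X) 1 ∧
    ∀ x : X, ‖NormedSpace.inclusionInDoubleDual ℝ X x + u‖ = 1 + ‖x‖}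

/-! The Daugavet equation for `f ⊗ x` says that slices of the ball contain `y` with `‖x + y‖` almost
2. To pass from slices to weakly open sets, map the ball into a Euclidean space by finitely many
functionals. The limits of images of good points form a closed convex set, which contains every
farthest point of the closed image because slices shrink to such a point; hence it is the whole
closed image. Goldstine's theorem carries this to the bidual, and Baire's theorem on its weak-star
compact ball, over a dense sequence of `X`, makes the equality exact. Conversely, (2) is applied to
slices, and (4) is tested on the biadjoint of `f ⊗ x + I`. -/

open Metric Set Topology

/-! ### Farthest points in Hilbert space -/

/-- A closed convex set containing every point of a compact set `C` that is farthest in `C` from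
some centre contains all of `C`. -/
theorem IsCompact.subset_of_farthest_mem {H : Type*} [NormedAddCommGroup H]
    [InnerProductSpace ℝ H] [CompleteSpace H] {C Q : Set H} (hC : IsCompact C)
    (hQ : IsClosed Q) (hQc : Convex ℝ Q)
    (h : ∀ z, ∀ e ∈ C, (∀ p ∈ C, ‖p - z‖ ≤ ‖e - z‖) → e ∈ Q) : C ⊆ Q := by
  intro w hw
  by_contra hwQ
  obtain ⟨g, r, hgr, hrw⟩ := geometric_hahn_banach_closed_point hQc hQ hwQ
  set v : H := (InnerProductSpace.toDual ℝ H).symm g with hv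
  have hg : ∀ p, g p = inner ℝ v p := fun p => by
    rw [hv, InnerProductSpace.toDual_symm_apply]
  obtain ⟨M, hM⟩ := hC.isBounded.exists_norm_le
  -- With the centre this far out in direction `-v`, the linear term of the squared distance
  -- outweighs `‖p‖ ^ 2 ≤ M ^ 2`, so no point with `g p < r` can be farthest.
  set l : ℝ := (M ^ 2 + 1) / (2 * (g w - r)) with hl
  have hpos : 0 < g w - r := by linarith
  have hl0 : 0 < l := by positivity
  have hl2 : 2 * l * (g w - r) = M ^ 2 + 1 := by
    rw [hl]; field_simp
  obtain ⟨e, heC, he⟩ := hC.exists_isMaxOn ⟨w, hw⟩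
    (f := fun p => ‖p - (-(l • v))‖) (by fun_prop)
  have heQ := h _ e heC (fun p hp => he hp)
  have h1 : ‖w - (-(l • v))‖ ≤ ‖e - (-(l • v))‖ := he hw
  have key : ∀ p : H, ‖p - (-(l • v))‖ ^ 2 = ‖p‖ ^ 2 + 2 * l * g p + ‖l • v‖ ^ 2 := by
    intro p
    rw [sub_neg_eq_add, norm_add_sq_real, inner_smul_right, hg, real_inner_comm]
    ring
  have h2 := pow_le_pow_left₀ (norm_nonneg _) h1 2
  rw [key, key] at h2
  have h3 : ‖e‖ ^ 2 ≤ M ^ 2 := pow_le_pow_left₀ (norm_nonneg _) (hM e heC) 2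
  have h4 := mul_lt_mul_of_pos_left (hgr e heQ) hl0
  nlinarith [sq_nonneg ‖w‖]

/-- In an inner product space, a point of `C` with almost maximal inner product against `e - z`,
where `e` is farthest from `z`, is close to `e`. -/
theorem norm_sub_sq_le_of_farthest {H : Type*} [NormedAddCommGroup H] [InnerProductSpace ℝ H]
    {e z p : H} (hp : ‖p - z‖ ≤ ‖e - z‖) :
    ‖p - e‖ ^ 2 ≤ 2 * (inner ℝ (e - z) e - inner ℝ (e - z) p) := by
  have h1 : p - e = (p - z) - (e - z) := by abel
  have h2 := pow_le_pow_left₀ (norm_nonneg _) hp 2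
  have h3 : inner ℝ (e - z) e - inner ℝ (e - z) p
      = ‖e - z‖ ^ 2 - inner ℝ (p - z) (e - z) := by
    rw [real_inner_comm (e - z) (p - z), ← real_inner_self_eq_norm_sq, ← inner_sub_right,
      ← inner_sub_right]
    congr 1; abel
  rw [h3, h1, norm_sub_sq_real]
  linarith

section NormedSpace

variable {X : Type*} [NormedAddCommGroup X] [NormedSpace ℝ X]

/-- Subtract `|a - b|` times one of the vectors from `max a b • (x + y)`. -/
theorem norm_smul_add_smul_ge {x y : X} (hx : ‖x‖ ≤ 1) (hy : ‖y‖ ≤ 1) {a b δ : ℝ}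
    (ha : 0 ≤ a) (hb : 0 ≤ b) (hδ : 0 ≤ δ) (h : 2 - δ ≤ ‖x + y‖) :
    a + b - (a + b) * δ ≤ ‖a • x + b • y‖ := by
  rcases le_total a b with hab | hab
  · have h1 : b • (x + y) = (a • x + b • y) + (b - a) • x := by module
    have h2 := norm_add_le (a • x + b • y) ((b - a) • x)
    rw [← h1, norm_smul, norm_smul, Real.norm_of_nonneg hb,
      Real.norm_of_nonneg (sub_nonneg.2 hab)] at h2
    nlinarith [mul_le_mul_of_nonneg_left h hb, mul_nonneg ha hδ]
  · have h1 : a • (x + y) = (a • x + b • y) + (a - b) • y := by module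
    have h2 := norm_add_le (a • x + b • y) ((a - b) • y)
    rw [← h1, norm_smul, norm_smul, Real.norm_of_nonneg ha,
      Real.norm_of_nonneg (sub_nonneg.2 hab)] at h2
    nlinarith [mul_le_mul_of_nonneg_left h ha, mul_nonneg hb hδ]

theorem ContinuousLinearMap.finrank_range_smulRight {f : StrongDual ℝ X} {x : X} (hf : f ≠ 0)
    (hx : x ≠ 0) :
    Module.finrank ℝ (LinearMap.range ((f.smulRight x : X →L[ℝ] X) : X →ₗ[ℝ] X)) = 1 := by
  have : LinearMap.range ((f.smulRight x : X →L[ℝ] X) : X →ₗ[ℝ] X)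
      = Submodule.span ℝ {x} := by
    obtain ⟨y, hy⟩ : ∃ y, f y ≠ 0 := by
      by_contra! h
      exact hf (ContinuousLinearMap.ext h)
    ext z
    rw [Submodule.mem_span_singleton, LinearMap.mem_range]
    constructor
    · rintro ⟨w, rfl⟩
      exact ⟨f w, rfl⟩
    · rintro ⟨a, rfl⟩
      refine ⟨(a / f y) • y, ?_⟩
      simp [smul_smul, div_mul_cancel₀ _ hy]
  rw [this, finrank_span_singleton hx]

theorem ContinuousLinearMap.exists_eq_smulRight_of_finrank_range_eq_one {T : X →L[ℝ] X}
    (hT : Module.finrank ℝ (LinearMap.range (T : X →ₗ[ℝ] X)) = 1) :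
    ∃ (f : StrongDual ℝ X) (x : X), T = f.smulRight x := by
  obtain ⟨⟨v, hvT⟩, hv0, hv⟩ := finrank_eq_one_iff'.1 hT
  have hv0' : v ≠ 0 := fun h => hv0 (Subtype.ext h)
  obtain ⟨g, hg⟩ := SeparatingDual.exists_eq_one (R := ℝ) hv0'
  refine ⟨g.comp T, v, ?_⟩
  ext y
  obtain ⟨c, hc⟩ := hv ⟨T y, y, rfl⟩
  have hc' : c • v = T y := congrArg Subtype.val hc
  simp [← hc', hg]

/-- It suffices to prove `1 + ‖T‖ ≤ ‖T + I‖` for `T = f ⊗ x`, with `x` arbitrary. -/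
theorem hasDaugavetProperty_of_forall_smulRight [Nontrivial X]
    (h : ∀ (f : StrongDual ℝ X) (x : X), x ≠ 0 →
      1 + ‖f‖ * ‖x‖ ≤ ‖f.smulRight x + ContinuousLinearMap.id ℝ X‖) :
    HasDaugavetProperty X := by
  intro T hT
  obtain ⟨f, x, rfl⟩ := T.exists_eq_smulRight_of_finrank_range_eq_one hT
  have hx : x ≠ 0 := by
    rintro rfl
    have h0 : ((f.smulRight (0 : X) : X →L[ℝ] X) : X →ₗ[ℝ] X) = 0 := by ext; simp
    rw [h0, LinearMap.range_zero, finrank_bot] at hT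
    exact zero_ne_one hT
  apply le_antisymm
  · refine (norm_add_le _ _).trans ?_
    rw [ContinuousLinearMap.norm_id, add_comm]
  · rw [ContinuousLinearMap.norm_smulRight_apply]
    exact h f x hx

/-! ### From the Daugavet equation to slices -/

theorem exists_norm_le_one_lt_apply (f : StrongDual ℝ X) {c : ℝ} (hc : c < ‖f‖) :
    ∃ y, ‖y‖ ≤ 1 ∧ c < f y := by
  by_contra! h
  have hc0 : 0 ≤ c := by simpa using h 0 (by simp)
  refine hc.not_ge (f.opNorm_le_of_unit_norm hc0 fun y hy => ?_)
  rw [Real.norm_eq_abs, abs_le]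
  have := h (-y) (by simp [hy])
  rw [map_neg] at this
  exact ⟨by linarith, h y hy.le⟩

theorem HasDaugavetProperty.exists_mem_slice_of_norm_eq_one (hD : HasDaugavetProperty X)
    [Nontrivial X] {f : StrongDual ℝ X} (hf : ‖f‖ = 1) {x : X} (hx : ‖x‖ = 1) {δ : ℝ}
    (hδ : 0 < δ) : ∃ y, ‖y‖ ≤ 1 ∧ 1 - δ < f y ∧ 2 - δ < ‖x + y‖ := by
  have hT := hD (f.smulRight x) (ContinuousLinearMap.finrank_range_smulRight
    (norm_ne_zero_iff.1 (by simp [hf])) (norm_ne_zero_iff.1 (by simp [hx])))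
  rw [ContinuousLinearMap.norm_smulRight_apply, hf, hx] at hT
  obtain ⟨y, hy1, hy⟩ : ∃ y, ‖y‖ ≤ 1 ∧ 2 - δ / 2 < ‖f y • x + y‖ := by
    by_contra! h
    have h0 : 0 ≤ 2 - δ / 2 := by simpa using h 0 (by simp)
    have := (f.smulRight x + ContinuousLinearMap.id ℝ X).opNorm_le_of_unit_norm h0
      fun y hy => by simpa using h y hy.le
    linarith
  wlog hfy : 0 ≤ f y generalizing y
  · refine this (-y) (by simpa using hy1) ?_ (by rw [map_neg]; linarith)
    rwa [map_neg, neg_smul, ← neg_add, norm_neg]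
  have hfy1 : f y ≤ 1 := by
    have := (le_abs_self _).trans (f.le_opNorm y)
    rw [hf, one_mul] at this
    exact this.trans hy1
  refine ⟨y, hy1, ?_, ?_⟩
  · have := norm_add_le (f y • x) y
    rw [norm_smul, hx, Real.norm_of_nonneg hfy] at this
    linarith
  -- Replacing `f y` by 1 costs `1 - f y < δ / 2`, the other half of the error.
  · have h1 : f y • x + y = (x + y) - (1 - f y) • x := by module
    have h2 := norm_sub_le (x + y) ((1 - f y) • x)
    have h3 := norm_add_le (f y • x) y
    rw [norm_smul, hx, Real.norm_of_nonneg hfy] at h3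
    rw [← h1, norm_smul, hx, Real.norm_of_nonneg (by linarith)] at h2
    linarith

/-- In a space with the Daugavet property every slice of the unit ball contains, for each `x` and
`t ≥ 0`, points `y` with `‖x + t y‖` almost equal to `‖x‖ + t`. -/
theorem HasDaugavetProperty.exists_mem_slice (hD : HasDaugavetProperty X) [Nontrivial X]
    {f : StrongDual ℝ X} {c : ℝ} (hc : ∃ y, ‖y‖ ≤ 1 ∧ c < f y) (x : X) {t ε : ℝ} (ht : 0 ≤ t)
    (hε : 0 < ε) : ∃ y, ‖y‖ ≤ 1 ∧ c < f y ∧ ‖x‖ + t - ε < ‖x + t • y‖ := by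
  obtain ⟨f', hf', d, hd, hdc⟩ : ∃ f' : StrongDual ℝ X, ‖f'‖ = 1 ∧
      ∃ d > 0, ∀ y, 1 - d < f' y → c < f y := by
    obtain ⟨y₀, hy₀, hcy₀⟩ := hc
    rcases eq_or_ne f 0 with rfl | hf
    · obtain ⟨v, hv⟩ := exists_ne (0 : X)
      obtain ⟨g, hg, -⟩ := exists_dual_vector ℝ v (norm_ne_zero_iff.2 hv)
      exact ⟨g, hg, 1, one_pos, fun _ _ => by simpa using hcy₀⟩
    · have hf0 : 0 < ‖f‖ := norm_pos_iff.2 hf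
      have hcf : c < ‖f‖ := hcy₀.trans_le
        ((le_abs_self _).trans ((f.le_opNorm y₀).trans (mul_le_of_le_one_right hf0.le hy₀)))
      refine ⟨‖f‖⁻¹ • f, norm_smul_inv_norm hf, (‖f‖ - c) / ‖f‖, by
        have : 0 < ‖f‖ - c := by linarith
        positivity, fun y hy => ?_⟩
      have h1 : 1 - (‖f‖ - c) / ‖f‖ = c / ‖f‖ := by field_simp; ring
      rw [h1, smul_apply, smul_eq_mul, div_eq_inv_mul] at hy
      exact lt_of_mul_lt_mul_left hy (by positivity)
  obtain ⟨x', hx', hxx'⟩ : ∃ x' : X, ‖x'‖ = 1 ∧ x = ‖x‖ • x' := by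
    rcases eq_or_ne x 0 with rfl | hx
    · obtain ⟨v, hv⟩ := exists_norm_eq X (zero_le_one' ℝ)
      exact ⟨v, hv, by simp⟩
    · exact ⟨‖x‖⁻¹ • x, norm_smul_inv_norm hx, by
        rw [smul_smul, mul_inv_cancel₀ (norm_ne_zero_iff.2 hx), one_smul]⟩
  have hs : 0 < ‖x‖ + t + 1 := by positivity
  set δ := min d (ε / (‖x‖ + t + 1)) with hδdef
  have hδ : 0 < δ := lt_min hd (by positivity)
  obtain ⟨y, hy1, hfy, hy⟩ := hD.exists_mem_slice_of_norm_eq_one hf' hx' hδ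
  refine ⟨y, hy1, hdc y (by linarith [min_le_left d (ε / (‖x‖ + t + 1))]), ?_⟩
  have h1 := norm_smul_add_smul_ge hx'.le hy1 (norm_nonneg x) ht hδ.le hy.le
  rw [← hxx'] at h1
  have h2 : δ * (‖x‖ + t + 1) ≤ ε := (le_div_iff₀ hs).1 (min_le_right _ _)
  linarith

/-! ### From slices to weak neighbourhoods -/

/-- Every point of the closure of the image of the unit ball under a bounded operator into a
finite-dimensional inner product space is approximated by the images of points `y` with `‖x + t y‖`
almost equal to `‖x‖ + t`. -/
theorem HasDaugavetProperty.exists_image_near (hD : HasDaugavetProperty X) [Nontrivial X]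
    {H : Type*} [NormedAddCommGroup H] [InnerProductSpace ℝ H] [FiniteDimensional ℝ H]
    (Φ : X →L[ℝ] H) {p : H} (hp : p ∈ closure (Φ '' closedBall 0 1)) (x : X)
    {t ε δ : ℝ} (ht : 0 ≤ t) (hε : 0 < ε) (hδ : 0 < δ) :
    ∃ y, ‖y‖ ≤ 1 ∧ ‖Φ y - p‖ < δ ∧ ‖x‖ + t - ε < ‖x + t • y‖ := by
  have : ProperSpace H := FiniteDimensional.proper_real H
  let Q : Set H := {p | ∀ (x : X) (t ε δ : ℝ), 0 ≤ t → 0 < ε → 0 < δ →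
    ∃ y, ‖y‖ ≤ 1 ∧ ‖Φ y - p‖ < δ ∧ ‖x‖ + t - ε < ‖x + t • y‖}
  suffices h : closure (Φ '' closedBall 0 1) ⊆ Q from h hp x t ε δ ht hε hδ
  have hbd : Bornology.IsBounded (Φ '' closedBall 0 1) :=
    Φ.lipschitz.isBounded_image isBounded_closedBall
  refine hbd.isCompact_closure.subset_of_farthest_mem ?_ ?_ ?_
  · refine isClosed_of_closure_subset fun p hp x t ε δ ht hε hδ => ?_
    obtain ⟨q, hq, hpq⟩ := Metric.mem_closure_iff.1 hp (δ / 2) (by positivity)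
    obtain ⟨y, hy1, hy, hxy⟩ := hq x t ε (δ / 2) ht hε (by positivity)
    refine ⟨y, hy1, ?_, hxy⟩
    rw [dist_comm, dist_eq_norm] at hpq
    have := norm_sub_le_norm_sub_add_norm_sub (Φ y) q p
    linarith
  · intro p hp q hq a b ha hb hab x t ε δ ht hε hδ
    obtain ⟨y, hy1, hy, hxy⟩ := hp x (t * a) (ε / 2) δ (by positivity) (by positivity) hδ
    -- Choosing `z` relative to `x + (t * a) • y` makes the two norm gains add up.
    obtain ⟨z, hz1, hz, hxz⟩ := hq (x + (t * a) • y) (t * b) (ε / 2) δ (by positivity)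
      (by positivity) hδ
    have hyB : y ∈ closedBall (0 : X) 1 := by simpa using hy1
    have hzB : z ∈ closedBall (0 : X) 1 := by simpa using hz1
    refine ⟨a • y + b • z, by
      simpa using convex_closedBall (0 : X) 1 hyB hzB ha hb hab, ?_, ?_⟩
    · have hy' : Φ y ∈ ball p δ := by rwa [mem_ball, dist_eq_norm]
      have hz' : Φ z ∈ ball q δ := by rwa [mem_ball, dist_eq_norm]
      have h1 : Φ (a • y + b • z) - (a • p + b • q) = a • (Φ y - p) + b • (Φ z - q) := by
        simp only [map_add, map_smul]; module
      have h2 := convex_ball (0 : H) δ (by simpa using hy : Φ y - p ∈ ball 0 δ)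
        (by simpa using hz : Φ z - q ∈ ball 0 δ) ha hb hab
      rw [h1]
      simpa using h2
    · have h1 : x + t • (a • y + b • z) = x + (t * a) • y + (t * b) • z := by module
      have h2 : t * a + t * b = t := by rw [← mul_add, hab, mul_one]
      rw [h1]
      linarith
  · intro z e he hez x t ε δ ht hε hδ
    set g : StrongDual ℝ H := innerSL ℝ (e - z) with hg
    -- Depth `δ ^ 2 / 2` is what `norm_sub_sq_le_of_farthest` turns into distance `δ`.
    obtain ⟨_, ⟨y₀, hy₀, rfl⟩, hey₀⟩ : ∃ q ∈ Φ '' closedBall 0 1, g e - δ ^ 2 / 2 < g q := by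
      refine (_root_.mem_closure_iff.1 he {q | g e - δ ^ 2 / 2 < g q}
        (isOpen_lt continuous_const g.continuous) ?_).imp fun q hq => ⟨hq.2, hq.1⟩
      simp only [mem_ofPred_eq]
      have : 0 < δ ^ 2 := by positivity
      linarith
    obtain ⟨y, hy1, hgy, hxy⟩ := hD.exists_mem_slice (f := g.comp Φ)
      ⟨y₀, by simpa using hy₀, hey₀⟩ x ht hε
    refine ⟨y, hy1, ?_, hxy⟩
    have h1 := norm_sub_sq_le_of_farthest
      (hez (Φ y) (subset_closure ⟨y, by simpa using hy1, rfl⟩))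
    have h2 : g e - δ ^ 2 / 2 < g (Φ y) := hgy
    rw [hg, innerSL_apply_apply, innerSL_apply_apply] at h2
    exact lt_of_pow_lt_pow_left₀ 2 hδ.le (by linarith)

/-- The operator into Euclidean space whose coordinates are given functionals. -/
noncomputable def euclideanPi {ι : Type*} [Fintype ι] (f : ι → StrongDual ℝ X) :
    X →L[ℝ] EuclideanSpace ℝ ι :=
  (EuclideanSpace.equiv ι ℝ).symm.toContinuousLinearMap.comp (ContinuousLinearMap.pi f)

@[simp]
theorem euclideanPi_apply {ι : Type*} [Fintype ι] (f : ι → StrongDual ℝ X) (y : X) (i : ι) :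
    euclideanPi f y i = f i y := rfl

/-- Goldstine's theorem for finitely many functionals. -/
theorem toLp_apply_mem_closure_image_closedBall {ι : Type*} [Fintype ι] (f : ι → StrongDual ℝ X)
    {u : Bidual X} (hu : ‖u‖ ≤ 1) :
    WithLp.toLp 2 (fun i => u (f i)) ∈ closure (euclideanPi f '' closedBall 0 1) := by
  by_contra hp
  obtain ⟨g, r, hgr, hrp⟩ := geometric_hahn_banach_closed_point
    (((convex_closedBall (0 : X) 1).linear_image
      (euclideanPi f : X →ₗ[ℝ] EuclideanSpace ℝ ι)).closure) isClosed_closure hp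
  set v := (InnerProductSpace.toDual ℝ (EuclideanSpace ℝ ι)).symm g with hv
  have hg : ∀ p, g p = ∑ i, v i * p i := fun p => by
    rw [← InnerProductSpace.toDual_symm_apply, ← hv, PiLp.inner_apply]
    simp [mul_comm]
  set F : StrongDual ℝ X := ∑ i, v i • f i with hF
  have hr : ∀ y, ‖y‖ ≤ 1 → F y ≤ r := fun y hy => by
    have := hgr _ (subset_closure ⟨y, by simpa using hy, rfl⟩)
    rw [hg] at this
    simpa [hF, sum_apply] using this.le
  have hFr : ‖F‖ ≤ r := by
    by_contra! h
    obtain ⟨y, hy, hry⟩ := exists_norm_le_one_lt_apply F h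
    exact hry.not_ge (hr y hy)
  have huF : u F ≤ r := calc
    u F ≤ ‖u‖ * ‖F‖ := (le_abs_self _).trans (u.le_opNorm F)
    _ ≤ ‖F‖ := mul_le_of_le_one_left (norm_nonneg _) hu
    _ ≤ r := hFr
  rw [hg] at hrp
  simp only [hF, map_sum, map_smul, smul_eq_mul] at huF
  exact hrp.not_ge huF

/-- In a space with the Daugavet property, the points `y` of the unit ball with `‖x + t y‖` almost
equal to `‖x‖ + t` are weak-star dense in the unit ball of the bidual. -/
theorem HasDaugavetProperty.exists_mem_of_isOpen_pi (hD : HasDaugavetProperty X) [Nontrivial X]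
    {O : Set (StrongDual ℝ X → ℝ)} (hO : IsOpen O) {u : Bidual X} (hu : ‖u‖ ≤ 1)
    (huO : (fun f => u f) ∈ O) (x : X) {t ε : ℝ} (ht : 0 ≤ t) (hε : 0 < ε) :
    ∃ y, ‖y‖ ≤ 1 ∧ (fun f : StrongDual ℝ X => f y) ∈ O ∧ ‖x‖ + t - ε < ‖x + t • y‖ := by
  obtain ⟨I, U, hU, hUO⟩ := isOpen_pi_iff.1 hO _ huO
  set Φ := euclideanPi (fun i : ↥I => (i : StrongDual ℝ X))
  have hopen : IsOpen {q : EuclideanSpace ℝ ↥I | ∀ i : ↥I, q i ∈ U i} := by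
    simp only [ofPred_forall]
    exact isOpen_iInter_of_finite fun i : ↥I =>
      (hU _ i.2).1.preimage (EuclideanSpace.proj (𝕜 := ℝ) i).continuous
  obtain ⟨δ, hδ, hball⟩ := Metric.isOpen_iff.1 hopen
    (WithLp.toLp 2 fun i : ↥I => u (i : StrongDual ℝ X)) fun i : ↥I => (hU _ i.2).2
  obtain ⟨y, hy1, hy, hxy⟩ := hD.exists_image_near Φ
    (toLp_apply_mem_closure_image_closedBall _ hu) x ht hε hδ
  refine ⟨y, hy1, hUO fun f hf => ?_, hxy⟩
  exact hball (by rwa [mem_ball, dist_eq_norm] : Φ y ∈ ball _ δ) (⟨f, hf⟩ : ↥I)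

open NormedSpace

theorem HasDaugavetProperty.exists_mem_of_isRelWeaklyOpenInBall (hD : HasDaugavetProperty X)
    [Nontrivial X] {W : Set X} (hW : IsRelWeaklyOpenInBall W) (hne : W.Nonempty) (x : X)
    {t ε : ℝ} (ht : 0 ≤ t) (hε : 0 < ε) : ∃ y ∈ W, ‖x‖ + t - ε < ‖x + t • y‖ := by
  obtain ⟨V, hV, rfl⟩ := hW
  obtain ⟨w, hw1, hwV⟩ := hne
  obtain ⟨O, hO, rfl⟩ := isOpen_induced_iff.1 hV
  have hw : ‖inclusionInDoubleDual ℝ X w‖ ≤ 1 :=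
    (double_dual_bound ℝ X w).trans (by simpa using hw1)
  obtain ⟨y, hy1, hyO, hxy⟩ := hD.exists_mem_of_isOpen_pi hO hw hwV x ht hε
  exact ⟨y, ⟨by simpa using hy1, hyO⟩, hxy⟩

/-! ### Baire category in the bidual ball -/

theorem HasDaugavetProperty.exists_mem_of_isRelWeakStarOpenInBidualBall
    (hD : HasDaugavetProperty X) [Nontrivial X] [TopologicalSpace.SeparableSpace X]
    {W : Set (Bidual X)} (hW : IsRelWeakStarOpenInBidualBall W) (hne : W.Nonempty) :
    ∃ u ∈ sphere (0 : Bidual X) 1 ∩ W, ∀ x : X, ‖inclusionInDoubleDual ℝ X x + u‖ = 1 + ‖x‖ := by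
  obtain ⟨V, hV, rfl⟩ := hW
  obtain ⟨w, hw1, hwV⟩ := hne
  let K : Set (WeakDual ℝ (StrongDual ℝ X)) := WeakDual.toStrongDual ⁻¹' closedBall 0 1
  have : CompactSpace K := isCompact_iff_compactSpace.1 (WeakDual.isCompact_closedBall _ _)
  -- Witnessing a large norm by a functional `f` makes `G n` a union of weak-star open sets.
  let G : ℕ × ℕ → Set K := fun n => {u | ∃ f : StrongDual ℝ X, ‖f‖ ≤ 1 ∧
    ‖TopologicalSpace.denseSeq X n.1‖ + 1 - 1 / ((n.2 : ℝ) + 1) <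
      f (TopologicalSpace.denseSeq X n.1) + u.1 f}
  have hGo : ∀ n, IsOpen (G n) := fun n => by
    simp only [G, ofPred_exists]
    refine isOpen_iUnion fun f => ?_
    by_cases hf : ‖f‖ ≤ 1
    · simp only [hf, true_and]
      exact isOpen_lt continuous_const
        (continuous_const.add ((WeakDual.eval_continuous f).comp continuous_subtype_val))
    · simp [hf]
  have hGd : ∀ n, Dense (G n) := fun n => by
    rw [dense_iff_inter_open]
    rintro _ ⟨V', hV', rfl⟩ ⟨u, hu⟩
    obtain ⟨O, hO, rfl⟩ := isOpen_induced_iff.1 hV'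
    obtain ⟨y, hy1, hyO, hxy⟩ := hD.exists_mem_of_isOpen_pi hO
      (u := WeakDual.toStrongDual u.1) (mem_closedBall_zero_iff.1 u.2) hu
      (TopologicalSpace.denseSeq X n.1) zero_le_one
      (ε := 1 / ((n.2 : ℝ) + 1)) (by positivity)
    rw [one_smul] at hxy
    obtain ⟨f, hf1, hf⟩ := exists_dual_vector'' ℝ (TopologicalSpace.denseSeq X n.1 + y)
    refine ⟨⟨StrongDual.toWeakDual (inclusionInDoubleDual ℝ X y),
      mem_closedBall_zero_iff.2 ((double_dual_bound ℝ X y).trans hy1)⟩, hyO, f, hf1, ?_⟩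
    rw [map_add] at hf
    exact hxy.trans_eq hf.symm
  obtain ⟨⟨u, huK⟩, huV, huG⟩ := (dense_iInter_of_isOpen hGo hGd).inter_open_nonempty
    (Subtype.val ⁻¹' V) (hV.preimage continuous_subtype_val)
    ⟨⟨StrongDual.toWeakDual w, hw1⟩, hwV⟩
  have hu1 : ‖WeakDual.toStrongDual u‖ ≤ 1 := mem_closedBall_zero_iff.1 huK
  have key : ∀ x : X, ‖inclusionInDoubleDual ℝ X x + WeakDual.toStrongDual u‖ = 1 + ‖x‖ := by
    have hcl : IsClosed {x : X |
        ‖inclusionInDoubleDual ℝ X x + WeakDual.toStrongDual u‖ = 1 + ‖x‖} :=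
      isClosed_eq (by fun_prop) (by fun_prop)
    refine fun x => hcl.closure_subset_iff.2 ?_
      (TopologicalSpace.denseRange_denseSeq X x)
    rintro _ ⟨n, rfl⟩
    set d := TopologicalSpace.denseSeq X n with hd
    apply le_antisymm
    · rw [add_comm]
      exact (norm_add_le _ _).trans (add_le_add hu1 (double_dual_bound ℝ X d))
    · refine le_of_forall_pos_le_add fun ε hε => ?_
      obtain ⟨m, hm⟩ := exists_nat_one_div_lt hε
      obtain ⟨f, hf1, hf⟩ := mem_iInter.1 huG (n, m)
      have h1 := (le_abs_self _).trans
        ((inclusionInDoubleDual ℝ X d + WeakDual.toStrongDual u).le_of_opNorm_le_of_le le_rfl hf1)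
      have h2 : ‖d‖ + 1 - 1 / ((m : ℝ) + 1) <
        (inclusionInDoubleDual ℝ X d + WeakDual.toStrongDual u) f := hf
      linarith
  refine ⟨WeakDual.toStrongDual u, ⟨?_, huK, huV⟩, key⟩
  simpa using key 0

/-! ### Back to the Daugavet property -/

theorem hasDaugavetProperty_of_forall_isRelWeaklyOpenInBall [Nontrivial X]
    (h : ∀ x ∈ sphere (0 : X) 1, ∀ W : Set X, IsRelWeaklyOpenInBall W → W.Nonempty →
      ∀ ε : ℝ, 0 < ε → ∃ y ∈ W, 2 - ε < ‖x + y‖) : HasDaugavetProperty X := by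
  refine hasDaugavetProperty_of_forall_smulRight fun f x hx => le_of_forall_pos_le_add ?_
  intro ε hε
  have hs : 0 < ‖f‖ * ‖x‖ + 1 + ‖x‖ := by positivity
  -- Scaling loses `η * (‖f‖ * ‖x‖ + 1)`; replacing `‖f‖` by `f y` loses at most `η * ‖x‖`.
  set η := ε / (‖f‖ * ‖x‖ + 1 + ‖x‖) with hη
  have hη0 : 0 < η := by positivity
  have hηε : η * (‖f‖ * ‖x‖ + 1 + ‖x‖) = ε := div_mul_cancel₀ _ hs.ne'
  obtain ⟨y₀, hy₀, hfy₀⟩ := exists_norm_le_one_lt_apply f (c := ‖f‖ - η) (by linarith)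
  have hx1 : ‖‖x‖⁻¹ • x‖ = 1 := norm_smul_inv_norm hx
  obtain ⟨y, ⟨hy1, hfy⟩, hy⟩ := h (‖x‖⁻¹ • x) (by simpa using hx1)
    (closedBall 0 1 ∩ toWeakSpace ℝ X ⁻¹' {y | ‖f‖ - η < topDualPairing ℝ X f y})
    ⟨_, isOpen_lt continuous_const (WeakBilin.eval_continuous (topDualPairing ℝ X).flip f), rfl⟩
    ⟨y₀, by simpa using hy₀, hfy₀⟩ η hη0
  have hfy' : ‖f‖ - η < f y := hfy
  have hy1' : ‖y‖ ≤ 1 := by simpa using hy1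
  have h1 := norm_smul_add_smul_ge hx1.le hy1' (a := ‖f‖ * ‖x‖) (by positivity) zero_le_one
    hη0.le hy.le
  rw [smul_smul, mul_assoc, mul_inv_cancel₀ (norm_ne_zero_iff.2 hx), mul_one, one_smul] at h1
  have hfle : f y ≤ ‖f‖ := (le_abs_self _).trans (f.unit_le_opNorm y hy1')
  have h2 : ‖f‖ • x + y = (f y • x + y) + (‖f‖ - f y) • x := by module
  have h3 := norm_add_le (f y • x + y) ((‖f‖ - f y) • x)
  rw [← h2, norm_smul, Real.norm_of_nonneg (by linarith)] at h3
  have h4 : ‖f y • x + y‖ ≤ ‖f.smulRight x + ContinuousLinearMap.id ℝ X‖ :=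
    (f.smulRight x + ContinuousLinearMap.id ℝ X).unit_le_opNorm y hy1'
  nlinarith [mul_le_mul_of_nonneg_right (by linarith : ‖f‖ - f y ≤ η) (norm_nonneg x)]

/-- The biadjoint of `f ⊗ x + I` sends `u` to `u f • x + u`, of norm `1 + |u f| * ‖x‖` for
octahedral `u`. The resulting bound is weak-star closed in `u`, so it reaches a `u₀` norming `f`. -/
theorem hasDaugavetProperty_of_subset_closure_octahedralElements [Nontrivial X]
    (h : (StrongDual.toWeakDual '' sphere (0 : Bidual X) 1 :
        Set (WeakDual ℝ (StrongDual ℝ X))) ⊆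
      closure (StrongDual.toWeakDual '' octahedralElements X)) : HasDaugavetProperty X := by
  refine hasDaugavetProperty_of_forall_smulRight fun f x hx => ?_
  have hx0 : 0 < ‖x‖ := norm_pos_iff.2 hx
  set S := f.smulRight x + ContinuousLinearMap.id ℝ X with hS
  have key : ∀ u ∈ octahedralElements X, 1 + u f * ‖x‖ ≤ ‖S‖ := by
    rintro u ⟨hu1, hu⟩
    have hu1' : ‖u‖ = 1 := by simpa using hu1
    have h1 : ‖inclusionInDoubleDual ℝ X (u f • x) + u‖ ≤ ‖S‖ := by
      refine ContinuousLinearMap.opNorm_le_bound _ (norm_nonneg _) fun g => ?_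
      have h2 : (inclusionInDoubleDual ℝ X (u f • x) + u) g = u (g.comp S) := by
        have h3 : g.comp S = g x • f + g := by
          ext y
          simp [hS, mul_comm]
        rw [h3]
        simp [mul_comm]
      rw [h2]
      refine (u.le_opNorm _).trans ?_
      rw [hu1', one_mul, mul_comm]
      exact g.opNorm_comp_le S
    rw [hu, norm_smul] at h1
    have := mul_le_mul_of_nonneg_right (Real.le_norm_self (u f)) hx0.le
    linarith
  obtain ⟨u₀, hu₀, hu₀f⟩ : ∃ u₀ : Bidual X, ‖u₀‖ = 1 ∧ u₀ f = ‖f‖ := by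
    rcases eq_or_ne f 0 with rfl | hf
    · obtain ⟨u, hu⟩ := exists_norm_eq (Bidual X) (zero_le_one' ℝ)
      exact ⟨u, hu, by simp⟩
    · exact exists_dual_vector ℝ f (norm_ne_zero_iff.2 hf)
  have hcl : IsClosed {u : WeakDual ℝ (StrongDual ℝ X) | 1 + u f * ‖x‖ ≤ ‖S‖} :=
    isClosed_le (continuous_const.add ((WeakDual.eval_continuous f).mul continuous_const))
      continuous_const
  have hmem := closure_minimal (by rintro _ ⟨u, hu, rfl⟩; exact key u hu) hcl
    (h ⟨u₀, by simpa using hu₀, rfl⟩)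
  rw [← hu₀f]
  exact hmem

end NormedSpace

theorem theorem3p2 (X : Type*) [NormedAddCommGroup X] [NormedSpace ℝ X] [CompleteSpace X]
    [Nontrivial X] [TopologicalSpace.SeparableSpace X] :
    List.TFAE [
      HasDaugavetProperty X,
      ∀ x ∈ Metric.sphere (0 : X) 1, ∀ W : Set X, IsRelWeaklyOpenInBall W → W.Nonempty →
        ∀ ε : ℝ, 0 < ε → ∃ y ∈ W, 2 - ε < ‖x + y‖,
      ∀ W : Set (Bidual X), IsRelWeakStarOpenInBidualBall W → W.Nonempty →
        ∃ u ∈ Metric.sphere (0 : Bidual X) 1 ∩ W,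
          ∀ x : X, ‖NormedSpace.inclusionInDoubleDual ℝ X x + u‖ = 1 + ‖x‖,
      (StrongDual.toWeakDual '' Metric.sphere (0 : Bidual X) 1 :
          Set (WeakDual ℝ (StrongDual ℝ X))) ⊆
        closure (StrongDual.toWeakDual '' octahedralElements X)] := by
  tfae_have 1 → 2 := by
    intro hD x hx W hW hne ε hε
    obtain ⟨y, hy, hxy⟩ := hD.exists_mem_of_isRelWeaklyOpenInBall hW hne x zero_le_one hε
    rw [one_smul, mem_sphere_zero_iff_norm.1 hx, one_add_one_eq_two] at hxy
    exact ⟨y, hy, hxy⟩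
  tfae_have 2 → 1 := hasDaugavetProperty_of_forall_isRelWeaklyOpenInBall
  tfae_have 1 → 3 := fun hD W hW hne =>
    hD.exists_mem_of_isRelWeakStarOpenInBidualBall hW hne
  tfae_have 3 → 4 := by
    rintro h _ ⟨w, hw, rfl⟩
    rw [_root_.mem_closure_iff]
    intro V hV hwV
    obtain ⟨u, ⟨hu1, -, huV⟩, hu⟩ := h _ ⟨V, hV, rfl⟩ ⟨w, sphere_subset_closedBall hw, hwV⟩
    exact ⟨StrongDual.toWeakDual u, huV, u, ⟨hu1, hu⟩, rfl⟩
  tfae_have 4 → 1 := hasDaugavetProperty_of_subset_closure_octahedralElements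
  tfae_finish
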